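/- Let $L^2(\partial\mathbb D)$ be taken with respect to normalized arc length on the unit circle, and let $H^2\subset L^2(\partial\mathbb D)$ be the Hardy space of the unit disk $\mathbb D$ (the functions whose Fourier coefficients of negative index vanish). For a finite Blaschke product $\alpha$, that is, $\alpha(z)=c\prod_{j=1}^m\frac{z-a_j}{1-\overline{a_j}z}$ with $|c|=1$ and $a_1,\dots,a_m\in\mathbb D$ (its degree is $m$), let $K_\alpha=H^2\ominus\alpha H^2$ be the model space, and for $w\in\overline{\mathbb D}$ put $$k_w^\alpha(z)=\frac{1-\overline{\alpha(w)}\alpha(z)}{1-\overline w z},\qquad \widetilde k_w^\alpha(z)=(C_\alpha k_w^\alpha)(z)=\alpha(z)\,\overline z\,\overline{k_w^\alpha(z)}=\frac{\alpha(z)-\alpha(w)}{z-w}\qquad(|z|=1,\ z\neq w).$$ For finite Blaschke products $\alpha,\beta$ let $P_\beta$ be the orthogonal projection of $L^2(\partial\mathbb D)$ onto $K_\beta$, and let $\mathscr T(\alpha,\beta)$ be the set of all bounded operators $A\colon K_\alpha\to K_\beta$ for which there is $\varphi\in L^2(\partial\mathbb D)$ with $Af=P_\beta(\varphi f)$ for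 all bounded $f\in K_\alpha$. For $f\in K_\alpha$ and $g\in K_\beta$ let $g\otimes f\colon K_\alpha\to K_\beta$ be the operator $(g\otimes f)h=\langle h,f\rangle g$. Let $\alpha$ and $\beta$ be finite Blaschke products of degree $m>1$ and $n>1$, respectively. Let $f\in K_\alpha$ and $g\in K_\beta$ be nonzero functions such that $g\otimes f\in\mathscr T(\alpha,\beta)$, and let $w\in\overline{\mathbb D}$. Then (a) $g$ is a scalar multiple of $k_w^\beta$ if and only if $f$ is a scalar multiple of $\widetilde k_w^\alpha$; (b) $g$ is a scalar multiple of $\widetilde k_w^\beta$ if and only if $f$ is a scalar multiple of $k_w^\alpha$. -/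

import Mathlib

open scoped ComplexConjugate ENNReal

noncomputable section

namespace ModelSpace

open MeasureTheory

/-- Normalised arc length `dθ / 2π` on the unit circle, parametrised by `ℝ / ℤ`. -/
abbrev arc : Measure UnitAddCircle := AddCircle.haarAddCircle

/-- The point `e^{2πit}` of the unit circle with parameter `t`. -/
def pt (t : UnitAddCircle) : ℂ := (AddCircle.toCircle t : ℂ)

/-- `L²(∂𝔻)`. -/
abbrev L2 : Type := Lp ℂ 2 arc

/-- The Hardy space `H²`, as the subspace of `L²(∂𝔻)` of all functions (boundary values) whose
Fourier coefficients of negative index vanish. -/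
def hardy : Submodule ℂ L2 :=
  (Submodule.span ℂ {e : L2 | ∃ n : ℤ, n < 0 ∧ e = fourierLp 2 n})ᗮ

theorem mem_hardy_iff (u : L2) : u ∈ hardy ↔ ∀ n : ℤ, n < 0 → fourierCoeff u n = 0 := by
  have key : ∀ n : ℤ, fourierCoeff u n = inner ℂ (fourierLp 2 n : L2) u := by
    intro n
    rw [← fourierBasis_repr, HilbertBasis.repr_apply_apply, coe_fourierBasis]
  rw [hardy, Submodule.mem_orthogonal]
  constructor
  · intro h n hn
    rw [key]
    exact h _ (Submodule.subset_span ⟨n, hn, rfl⟩)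
  · intro h e he
    induction he using Submodule.span_induction with
    | mem x hx => obtain ⟨n, hn, rfl⟩ := hx; rw [← key]; exact h n hn
    | zero => exact inner_zero_left _
    | add x y _ _ hx hy => rw [inner_add_left, hx, hy, add_zero]
    | smul c x _ hx => rw [inner_smul_left, hx, mul_zero]

/-- `α H²`, as a subspace of `L²(∂𝔻)`. -/
def mulHardy (α : ℂ → ℂ) : Submodule ℂ L2 where
  carrier := {h | ∃ u ∈ hardy, ∀ᵐ t ∂arc, h t = α (pt t) * u t}
  zero_mem' := by
    refine ⟨0, hardy.zero_mem, ?_⟩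
    filter_upwards [Lp.coeFn_zero ℂ 2 arc] with t ht
    rw [ht]; simp
  add_mem' := by
    rintro h₁ h₂ ⟨u₁, hu₁, e₁⟩ ⟨u₂, hu₂, e₂⟩
    refine ⟨u₁ + u₂, hardy.add_mem hu₁ hu₂, ?_⟩
    filter_upwards [e₁, e₂, Lp.coeFn_add h₁ h₂, Lp.coeFn_add u₁ u₂] with t a b c d
    rw [c, d, Pi.add_apply, Pi.add_apply, a, b, mul_add]
  smul_mem' := by
    rintro c h ⟨u, hu, e⟩
    refine ⟨c • u, hardy.smul_mem c hu, ?_⟩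
    filter_upwards [e, Lp.coeFn_smul c h, Lp.coeFn_smul c u] with t a b d
    rw [b, d, Pi.smul_apply, Pi.smul_apply, a, smul_eq_mul, smul_eq_mul, mul_left_comm]

/-- The model space `K_α = H² ⊖ αH²`. -/
def K (α : ℂ → ℂ) : Submodule ℂ L2 := hardy ⊓ (mulHardy α)ᗮ

instance (α : ℂ → ℂ) : CompleteSpace (K α) := by
  have h : IsClosed ((K α : Submodule ℂ L2) : Set L2) := by
    rw [K, Submodule.coe_inf]
    exact (Submodule.isClosed_orthogonal _).inter (Submodule.isClosed_orthogonal _)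
  exact h.completeSpace_coe

/-- `α` is a finite Blaschke product of degree `m` (as a function on the closed unit disk; its
values elsewhere are irrelevant). -/
def IsFiniteBlaschke (m : ℕ) (α : ℂ → ℂ) : Prop :=
  ∃ (c : ℂ) (a : Fin m → ℂ), ‖c‖ = 1 ∧ (∀ j, ‖a j‖ < 1) ∧
    ∀ z : ℂ, ‖z‖ ≤ 1 → α z = c * ∏ j, (z - a j) / (1 - conj (a j) * z)

/-- The reproducing kernel `k_w^α`. For `‖w‖ = 1` the denominator vanishes only at `z = w`. -/
def kernel (α : ℂ → ℂ) (w z : ℂ) : ℂ := (1 - conj (α w) * α z) / (1 - conj w * z)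

/-- The conjugation `C_α`, on functions on the unit circle. -/
def conjugation (α : ℂ → ℂ) (u : ℂ → ℂ) (z : ℂ) : ℂ := α z * conj z * conj (u z)

/-- The conjugate kernel `C_α k_w^α`, on the unit circle. -/
def conjKernel (α : ℂ → ℂ) (w : ℂ) : ℂ → ℂ := conjugation α (kernel α w)

/-- The usual closed form of the conjugate kernel on the unit circle. -/
theorem conjKernel_eq (α : ℂ → ℂ) (w z : ℂ) (hz : ‖z‖ = 1) (hα : ‖α z‖ = 1) :
    conjKernel α w z = (α z - α w) / (z - w) := by
  have h1 : z * conj z = 1 := by rw [Complex.mul_conj']; simp [hz]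
  have h2 : α z * conj (α z) = 1 := by rw [Complex.mul_conj']; simp [hα]
  have hd : z - w = z * (1 - w * conj z) := by linear_combination w * h1
  have hn : α z - α w = α z * (1 - α w * conj (α z)) := by linear_combination α w * h2
  have hi : conj z = z⁻¹ := eq_inv_of_mul_eq_one_right h1
  rw [hd, hn]
  simp only [conjKernel, conjugation, kernel, map_div₀, map_sub, map_mul, map_one,
    Complex.conj_conj]
  rw [mul_div_mul_comm, hi, div_eq_mul_inv (α z) z]

/-- The element `u` of `L²(∂𝔻)` is a scalar multiple of the function `k` on the unit circle. -/
def IsScalarMultiple (u : L2) (k : ℂ → ℂ) : Prop :=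
  ∃ c : ℂ, ∀ᵐ t ∂arc, u t = c * k (pt t)

/-- The product `φ f ∈ L²(∂𝔻)` of `φ ∈ L²(∂𝔻)` and a bounded `f`. -/
def mulBdd (φ f : L2) (hf : MemLp f ∞ arc) : L2 :=
  MemLp.toLp (fun t => φ t * f t) (hf.mul' (Lp.memLp φ))

/-- The bounded asymmetric truncated Toeplitz operators from `K_α` to `K_β`: bounded operators
`A` such that for some symbol `φ ∈ L²(∂𝔻)`, `A f = P_β (φ f)` for all bounded `f ∈ K_α`. -/
def attOperators (α β : ℂ → ℂ) : Set (K α →L[ℂ] K β) :=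
  {A | ∃ φ : L2, ∀ (f : K α) (hf : MemLp (f : L2) ∞ arc),
    A f = (K β).orthogonalProjectionOnto (mulBdd φ f hf)}

end ModelSpace

end

/-!
Let `D_α` be the space of `x ∈ K_α` with `zx ∈ K_α`. Since `|z| = 1`, every
`A ∈ 𝒯(α, β)` satisfies `⟨zy, A(zx)⟩ = ⟨y, Ax⟩` for `x ∈ D_α`, `y ∈ D_β`, so for `A = g ⊗ f`
`⟨f, zx⟩ ⟨zy, g⟩ = ⟨f, x⟩ ⟨y, g⟩`.
As `K_α = {p / ∏ (1 - āⱼz) : deg p < m}`, the subspaces `(z - w) D_α` and `(1 - w̄z) D_α` have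
codimension one in `K_α`, and their orthogonal complements there are spanned by `k_w^α` and
`k̃_w^α`. Thus `g ∈ ℂ k_w^β` says that `⟨g, zy⟩ = w ⟨g, y⟩` on `D_β`, and `f ∈ ℂ k̃_w^α` that
`⟨f, x⟩ = w̄ ⟨f, zx⟩` on `D_α`; cancelling in the displayed identity, each implies the other, which
is (a). The identity is symmetric in `f` and `g` up to conjugation, which gives (b).
-/

noncomputable section

namespace ModelSpace

open MeasureTheory Polynomial
open scoped InnerProductSpace

section Multiplication

variable {X 𝕜 : Type*} [TopologicalSpace X] [CompactSpace X] [MeasurableSpace X] [BorelSpace X]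
  [RCLike 𝕜] [SecondCountableTopologyEither X 𝕜] {μ : Measure X} [IsFiniteMeasure μ]
  {p : ℝ≥0∞} [Fact (1 ≤ p)]

/-- Multiplication of `L^p` functions by continuous functions on a compact space, as a continuous
linear map into the bounded operators on `L^p`. -/
def mulLp : C(X, 𝕜) →L[𝕜] Lp 𝕜 p μ →L[𝕜] Lp 𝕜 p μ :=
  (ContinuousLinearMap.mul 𝕜 𝕜).holderL μ ∞ p p ∘L ContinuousMap.toLp ∞ μ 𝕜

theorem coeFn_mulLp (φ : C(X, 𝕜)) (u : Lp 𝕜 p μ) : mulLp φ u =ᵐ[μ] fun t => φ t * u t := by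
  filter_upwards [(ContinuousLinearMap.mul 𝕜 𝕜).coeFn_holder (r := p)
    (ContinuousMap.toLp ∞ μ 𝕜 φ) u, ContinuousMap.coeFn_toLp (p := ∞) (𝕜 := 𝕜) μ φ] with t h₁ h₂
  exact h₁.trans (congrArg (· * u t) h₂)

@[simp]
theorem mulLp_one (u : Lp 𝕜 p μ) : mulLp 1 u = u := by
  apply Lp.ext
  filter_upwards [coeFn_mulLp 1 u] with t h
  rw [h, ContinuousMap.one_apply, one_mul]

theorem mulLp_mul (φ ψ : C(X, 𝕜)) (u : Lp 𝕜 p μ) : mulLp (φ * ψ) u = mulLp φ (mulLp ψ u) := by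
  apply Lp.ext
  filter_upwards [coeFn_mulLp (φ * ψ) u, coeFn_mulLp φ (mulLp ψ u), coeFn_mulLp ψ u]
    with t h₁ h₂ h₃
  rw [h₁, h₂, h₃, ContinuousMap.mul_apply, mul_assoc]

theorem mulLp_toLp (φ ψ : C(X, 𝕜)) :
    mulLp φ (ContinuousMap.toLp p μ 𝕜 ψ) = ContinuousMap.toLp p μ 𝕜 (φ * ψ) := by
  apply Lp.ext
  filter_upwards [coeFn_mulLp φ (ContinuousMap.toLp p μ 𝕜 ψ),
    ContinuousMap.coeFn_toLp (p := p) (𝕜 := 𝕜) μ ψ,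
    ContinuousMap.coeFn_toLp (p := p) (𝕜 := 𝕜) μ (φ * ψ)] with t h₁ h₂ h₃
  rw [h₁, h₂, h₃, ContinuousMap.mul_apply]

theorem inner_mulLp_left (φ : C(X, 𝕜)) (u v : Lp 𝕜 2 μ) :
    ⟪mulLp φ u, v⟫_𝕜 = ⟪u, mulLp (star φ) v⟫_𝕜 := by
  rw [L2.inner_def, L2.inner_def]
  refine integral_congr_ae ?_
  filter_upwards [coeFn_mulLp φ u, coeFn_mulLp (star φ) v] with t h₁ h₂
  rw [h₁, h₂, RCLike.inner_apply, RCLike.inner_apply, ContinuousMap.star_apply, map_mul,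
    RCLike.star_def]
  ring

end Multiplication

section Circle

/-- The coordinate function `z` on the unit circle. -/
def coord : C(UnitAddCircle, ℂ) := ⟨pt, continuous_subtype_val.comp AddCircle.continuous_toCircle⟩

@[simp]
theorem coord_apply (t : UnitAddCircle) : coord t = pt t := rfl

theorem injective_pt : Function.Injective pt :=
  Subtype.val_injective.comp (AddCircle.injective_toCircle one_ne_zero)

theorem norm_pt (t : UnitAddCircle) : ‖pt t‖ = 1 := Circle.norm_coe _

theorem star_coord_mul_coord : star coord * coord = 1 := by
  ext t
  simp [Complex.conj_mul', norm_pt]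

theorem coord_mul_star_coord : coord * star coord = 1 := by
  rw [mul_comm, star_coord_mul_coord]

theorem fourier_natCast (n : ℕ) : fourier n = coord ^ n := by
  ext t
  simp [fourier_apply, AddCircle.toCircle_nsmul, pt]

theorem fourier_neg_natCast (n : ℕ) : fourier (-n) = star coord ^ n := by
  ext t
  rw [fourier_neg, fourier_natCast, ContinuousMap.pow_apply, ContinuousMap.pow_apply, map_pow,
    ContinuousMap.star_apply, RCLike.star_def]

instance : Infinite UnitAddCircle :=
  (AddCircle.equivIco (1 : ℝ) 0).infinite_iff.mpr (Set.Ico_infinite (by norm_num)).to_subtype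

theorem ae_pt_ne (w : ℂ) : ∀ᵐ t ∂arc, pt t ≠ w := by
  have h : Set.Subsingleton {t | pt t = w} := fun s hs t ht => injective_pt (hs.trans ht.symm)
  rw [ae_iff]
  simpa using h.measure_zero arc

end Circle

section Hardy

/-- The element of `L²(∂𝔻)` represented by a continuous function. -/
abbrev toL2 : C(UnitAddCircle, ℂ) →L[ℂ] L2 := ContinuousMap.toLp 2 arc ℂ

theorem toL2_ne_zero {φ : C(UnitAddCircle, ℂ)} (hφ : φ ≠ 0) : toL2 φ ≠ 0 :=
  (map_ne_zero_iff _ (ContinuousMap.toLp_injective arc)).mpr hφ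

theorem inner_fourierLp (u : L2) (n : ℤ) : ⟪(fourierLp 2 n : L2), u⟫_ℂ = fourierCoeff u n := by
  rw [← fourierBasis_repr, HilbertBasis.repr_apply_apply, coe_fourierBasis]

theorem mem_hardy_iff_inner_eq_zero {u : L2} :
    u ∈ hardy ↔ ∀ n : ℕ, ⟪toL2 (star coord ^ (n + 1)), u⟫_ℂ = 0 := by
  simp only [← fourier_neg_natCast]
  rw [mem_hardy_iff]
  refine ⟨fun h n => (inner_fourierLp u _).trans (h _ (by omega)), fun h n hn => ?_⟩
  obtain ⟨k, rfl⟩ : ∃ k : ℕ, n = -((k + 1 : ℕ) : ℤ) := ⟨(-n - 1).toNat, by omega⟩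
  exact (inner_fourierLp u _).symm.trans (h k)

theorem toL2_one_mem_hardy : toL2 1 ∈ hardy := by
  rw [mem_hardy_iff_inner_eq_zero]
  intro n
  rw [← fourier_neg_natCast, ← pow_zero coord, ← fourier_natCast]
  exact orthonormal_fourier.inner_eq_zero (by omega)

theorem mulLp_coord_mem_hardy {u : L2} (hu : u ∈ hardy) : mulLp coord u ∈ hardy := by
  rw [mem_hardy_iff_inner_eq_zero] at hu ⊢
  intro n
  rw [← hu (n + 1), pow_succ' _ (n + 1), ← mulLp_toLp, inner_mulLp_left, star_star]

theorem inner_one_mulLp_coord {u : L2} (hu : u ∈ hardy) : ⟪toL2 1, mulLp coord u⟫_ℂ = 0 := by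
  rw [← mem_hardy_iff_inner_eq_zero.mp hu 0, zero_add, pow_one, ← mul_one (star coord),
    ← mulLp_toLp, inner_mulLp_left, star_star]

/-- The disc algebra, as the closed algebra of functions on the unit circle generated by `z`. -/
abbrev discAlgebra : Subalgebra ℂ C(UnitAddCircle, ℂ) := Algebra.elemental ℂ coord

theorem mulLp_mem_hardy {φ : C(UnitAddCircle, ℂ)} (hφ : φ ∈ discAlgebra) {u : L2}
    (hu : u ∈ hardy) : mulLp φ u ∈ hardy := by
  have hadjoin : ∀ ψ ∈ Algebra.adjoin ℂ {coord}, ∀ v ∈ hardy, mulLp ψ v ∈ hardy := by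
    intro ψ hψ
    induction hψ using Algebra.adjoin_induction with
    | mem x hx => obtain rfl := hx; exact fun v => mulLp_coord_mem_hardy
    | algebraMap r =>
      intro v hv
      rw [Algebra.algebraMap_eq_smul_one, map_smul, smul_apply, mulLp_one]
      exact hardy.smul_mem r hv
    | add x y _ _ hx hy =>
      intro v hv
      rw [map_add, add_apply]
      exact hardy.add_mem (hx v hv) (hy v hv)
    | mul x y _ _ hx hy =>
      intro v hv
      rw [mulLp_mul]
      exact hx _ (hy v hv)
  have hclosed : IsClosed (hardy : Set L2) := Submodule.isClosed_orthogonal _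
  exact hclosed.closure_subset
    (map_mem_closure (f := fun ψ => mulLp ψ u) (by fun_prop) hφ fun ψ hψ => hadjoin ψ hψ u hu)

theorem toL2_mem_hardy {φ : C(UnitAddCircle, ℂ)} (hφ : φ ∈ discAlgebra) : toL2 φ ∈ hardy := by
  simpa only [mulLp_toLp, mul_one] using mulLp_mem_hardy hφ toL2_one_mem_hardy

theorem aeval_coord_mem_discAlgebra (p : ℂ[X]) : aeval coord p ∈ discAlgebra :=
  Subalgebra.le_topologicalClosure _ (aeval_mem_adjoin_singleton ℂ coord)

/-- The Szegő kernel `1 / (1 - āz)` on the unit circle, for `|a| < 1`; for `|a| = 1` the inverse in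
`C(UnitAddCircle, ℂ)` does not exist and `Ring.inverse` gives `0`. -/
def szegoKernel (a : ℂ) : C(UnitAddCircle, ℂ) := Ring.inverse (1 - conj a • coord)

theorem norm_conj_smul_coord_lt_one {a : ℂ} (ha : ‖a‖ < 1) : ‖conj a • coord‖ < 1 := by
  rw [ContinuousMap.norm_lt_iff _ one_pos]
  intro t
  simpa [norm_pt] using ha

theorem one_sub_smul_coord_mul_szegoKernel {a : ℂ} (ha : ‖a‖ < 1) :
    (1 - conj a • coord) * szegoKernel a = 1 :=
  Ring.mul_inverse_cancel _ (isUnit_one_sub_of_norm_lt_one (norm_conj_smul_coord_lt_one ha))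

theorem szegoKernel_mem_discAlgebra {a : ℂ} (ha : ‖a‖ < 1) : szegoKernel a ∈ discAlgebra := by
  have hsum := hasSum_geom_series_inverse (conj a • coord) (norm_conj_smul_coord_lt_one ha)
  refine (Algebra.elemental.isClosed ℂ coord).mem_of_tendsto hsum (.of_forall fun s => ?_)
  exact sum_mem fun i _ => pow_mem (discAlgebra.smul_mem (Algebra.elemental.self_mem ℂ coord) _) i

end Hardy

section Blaschke

variable {m : ℕ}

/-- The denominator `∏ (1 - āⱼz)` of the Blaschke product with zeros `aⱼ`. -/
def den (a : Fin m → ℂ) : ℂ[X] := ∏ j, (1 - C (conj (a j)) * X)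

/-- The numerator `∏ (z - aⱼ)` of the Blaschke product with zeros `aⱼ`. -/
def num (a : Fin m → ℂ) : ℂ[X] := ∏ j, (X - C (a j))

theorem num_ne_zero (a : Fin m → ℂ) : num a ≠ 0 :=
  (monic_prod_of_monic _ _ fun j _ => monic_X_sub_C (a j)).ne_zero

theorem natDegree_num_le (a : Fin m → ℂ) : (num a).natDegree ≤ m :=
  (natDegree_prod_le _ _).trans (by simp)

theorem natDegree_den_le (a : Fin m → ℂ) : (den a).natDegree ≤ m := by
  refine (natDegree_prod_le _ _).trans ?_
  refine (Finset.sum_le_card_nsmul _ _ 1 fun j _ => ?_).trans (by simp)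
  compute_degree

theorem aeval_coord_den (a : Fin m → ℂ) :
    aeval coord (den a) = ∏ j, (1 - conj (a j) • coord) := by
  simp [den, map_prod, Algebra.algebraMap_eq_smul_one]

theorem aeval_coord_num (a : Fin m → ℂ) :
    aeval coord (num a) = coord ^ m * star (aeval coord (den a)) := by
  have hfactor (w : ℂ) : coord - algebraMap ℂ _ w = coord * star (1 - conj w • coord) := by
    rw [star_sub, star_one, star_smul, mul_sub, mul_one, mul_smul_comm, coord_mul_star_coord,
      Algebra.algebraMap_eq_smul_one, ← RCLike.star_def, star_star]
  simp only [aeval_coord_den, num, map_prod, map_sub, aeval_X, aeval_C, hfactor,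
    Finset.prod_mul_distrib, Finset.prod_const, Finset.card_univ, Fintype.card_fin, star_prod]

/-- The function `1 / ∏ (1 - āⱼz)` on the unit circle, for `|aⱼ| < 1`. -/
def invDen (a : Fin m → ℂ) : C(UnitAddCircle, ℂ) := ∏ j, szegoKernel (a j)

variable {a : Fin m → ℂ}

theorem aeval_coord_den_mul_invDen (ha : ∀ j, ‖a j‖ < 1) :
    aeval coord (den a) * invDen a = 1 := by
  rw [aeval_coord_den, invDen, ← Finset.prod_mul_distrib]
  exact Finset.prod_eq_one fun j _ => one_sub_smul_coord_mul_szegoKernel (ha j)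

theorem invDen_mem_discAlgebra (ha : ∀ j, ‖a j‖ < 1) : invDen a ∈ discAlgebra :=
  prod_mem fun j _ => szegoKernel_mem_discAlgebra (ha j)

/-- The function `p / ∏ (1 - āⱼz)` on the unit circle, as a linear function of the polynomial
`p`. -/
def ratio (a : Fin m → ℂ) : ℂ[X] →ₗ[ℂ] C(UnitAddCircle, ℂ) :=
  LinearMap.mulRight ℂ (invDen a) ∘ₗ (aeval coord).toLinearMap

theorem ratio_apply (a : Fin m → ℂ) (p : ℂ[X]) : ratio a p = aeval coord p * invDen a := rfl

theorem ratio_mul (a : Fin m → ℂ) (p q : ℂ[X]) : ratio a (p * q) = aeval coord p * ratio a q := by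
  rw [ratio_apply, ratio_apply, map_mul, mul_assoc]

theorem ratio_den (ha : ∀ j, ‖a j‖ < 1) : ratio a (den a) = 1 :=
  aeval_coord_den_mul_invDen ha

theorem ratio_mem_discAlgebra (ha : ∀ j, ‖a j‖ < 1) (p : ℂ[X]) : ratio a p ∈ discAlgebra :=
  mul_mem (aeval_coord_mem_discAlgebra p) (invDen_mem_discAlgebra ha)

/-- The boundary values of the Blaschke product with zeros `aⱼ` and unimodular constant `c`. -/
def boundaryValue (c : ℂ) (a : Fin m → ℂ) : C(UnitAddCircle, ℂ) := c • ratio a (num a)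

/-- The function `α` agrees on the closed disc with the Blaschke product with zeros `aⱼ` and
unimodular constant `c`; this is `IsFiniteBlaschke` with the parameters made explicit. -/
structure IsBlaschke (c : ℂ) (a : Fin m → ℂ) (α : ℂ → ℂ) : Prop where
  norm_const : ‖c‖ = 1
  norm_zero_lt : ∀ j, ‖a j‖ < 1
  apply_eq : ∀ z : ℂ, ‖z‖ ≤ 1 → α z = c * ∏ j, (z - a j) / (1 - conj (a j) * z)

theorem IsFiniteBlaschke.exists_isBlaschke {α : ℂ → ℂ} (hα : IsFiniteBlaschke m α) :
    ∃ (c : ℂ) (a : Fin m → ℂ), IsBlaschke c a α :=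
  let ⟨c, a, hc, ha, h⟩ := hα
  ⟨c, a, hc, ha, h⟩

namespace IsBlaschke

variable {c : ℂ} {α : ℂ → ℂ}

theorem star_mul_self_const (h : IsBlaschke c a α) : conj c * c = 1 := by
  simp [Complex.conj_mul', h.norm_const]

theorem star_boundaryValue_mul_boundaryValue (h : IsBlaschke c a α) :
    star (boundaryValue c a) * boundaryValue c a = 1 := by
  have hden := aeval_coord_den_mul_invDen h.norm_zero_lt
  have hden' := congrArg star hden
  have hpow : star coord ^ m * coord ^ m = 1 := by
    rw [← mul_pow, star_coord_mul_coord, one_pow]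
  rw [star_mul, star_one] at hden'
  rw [boundaryValue, ratio_apply, aeval_coord_num, star_smul, smul_mul_smul_comm,
    RCLike.star_def, h.star_mul_self_const, one_smul, star_mul, star_mul, star_star, star_pow]
  calc _ = (star (invDen a) * star (aeval coord (den a))) * (star coord ^ m * coord ^ m)
        * (aeval coord (den a) * invDen a) := by ring
    _ = 1 := by rw [hden', hpow, hden, one_mul, one_mul]

theorem boundaryValue_apply (h : IsBlaschke c a α) (t : UnitAddCircle) :
    boundaryValue c a t = α (pt t) := by
  have hszego (j) : szegoKernel (a j) t = (1 - conj (a j) * pt t)⁻¹ :=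
    eq_inv_of_mul_eq_one_right
      (congrArg (· t) (one_sub_smul_coord_mul_szegoKernel (h.norm_zero_lt j)))
  rw [h.apply_eq _ (norm_pt t).le, boundaryValue, ratio_apply, num, invDen]
  simp [map_prod, div_eq_mul_inv, Finset.prod_mul_distrib, hszego]

theorem norm_apply_pt (h : IsBlaschke c a α) (t : UnitAddCircle) : ‖α (pt t)‖ = 1 := by
  have hsq : (‖α (pt t)‖ : ℂ) ^ 2 = 1 := by
    rw [← Complex.conj_mul', ← h.boundaryValue_apply]
    exact congrArg (· t) h.star_boundaryValue_mul_boundaryValue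
  exact (pow_eq_one_iff_of_nonneg (norm_nonneg _) two_ne_zero).mp (mod_cast hsq)

end IsBlaschke

end Blaschke

section ModelSpaces

variable {m : ℕ} {c : ℂ} {a : Fin m → ℂ} {α : ℂ → ℂ}

theorem exists_coord_mul_aeval_eq {p : ℂ[X]} (hp : p ∈ degreeLT ℂ m) :
    ∃ q ∈ degreeLT ℂ m, coord * aeval coord q = coord ^ m * star (aeval coord p) := by
  rw [degreeLT_eq_span_X_pow, Finset.coe_image, Finset.coe_range] at hp
  induction hp using Submodule.span_induction with
  | mem p hp =>
    obtain ⟨k, hk : k < m, rfl⟩ := hp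
    refine ⟨X ^ (m - 1 - k), mem_degreeLT.mpr ?_, ?_⟩
    · rw [degree_X_pow]
      exact_mod_cast (by omega : m - 1 - k < m)
    · have hkk : coord ^ k * star coord ^ k = 1 := by
        rw [← mul_pow, coord_mul_star_coord, one_pow]
      have hm : coord ^ m = coord ^ (m - 1 - k + 1) * coord ^ k := by
        rw [← pow_add]
        congr 1
        omega
      rw [map_pow, map_pow, aeval_X, star_pow, hm, mul_assoc, hkk, mul_one, pow_succ']
  | zero => exact ⟨0, zero_mem _, by simp⟩
  | add p₁ p₂ _ _ h₁ h₂ =>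
    obtain ⟨q₁, hq₁, e₁⟩ := h₁
    obtain ⟨q₂, hq₂, e₂⟩ := h₂
    exact ⟨q₁ + q₂, add_mem hq₁ hq₂, by simp only [map_add, star_add, mul_add, e₁, e₂]⟩
  | smul r p _ h =>
    obtain ⟨q, hq, e⟩ := h
    refine ⟨conj r • q, Submodule.smul_mem _ _ hq, ?_⟩
    rw [map_smul, map_smul, star_smul, mul_smul_comm, mul_smul_comm, e, RCLike.star_def]

theorem exists_toL2_aeval_eq_of_mem_hardy {v : L2} (hv : v ∈ hardy)
    (hm : ∀ k, ⟪toL2 (coord ^ (m + k)), v⟫_ℂ = 0) :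
    ∃ p ∈ degreeLT ℂ m, toL2 (aeval coord p) = v := by
  have hzero (i : ℤ) (hi : i ∉ (Finset.range m).map Nat.castEmbedding) : fourierCoeff v i = 0 := by
    rcases lt_or_ge i 0 with h | h
    · exact (mem_hardy_iff v).mp hv i h
    · lift i to ℕ using h
      obtain ⟨k, rfl⟩ : ∃ k, i = m + k := Nat.exists_eq_add_of_le (by simpa using hi)
      rw [← hm k, ← fourier_natCast]
      exact (inner_fourierLp v _).symm
  have hsum := (hasSum_fourier_series_L2 v).unique
    (hasSum_sum_of_ne_finset_zero fun i hi => by rw [hzero i hi, zero_smul])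
  refine ⟨∑ k ∈ Finset.range m, monomial k (fourierCoeff v k), sum_mem fun k hk => ?_, ?_⟩
  · exact mem_degreeLT.mpr ((degree_monomial_le _ _).trans_lt
      (mod_cast Finset.mem_range.mp hk))
  · rw [map_sum, map_sum]
    refine Eq.trans ?_ (hsum.trans (Finset.sum_map ..)).symm
    refine Finset.sum_congr rfl fun k _ => ?_
    rw [aeval_monomial, ← Algebra.smul_def, map_smul, ← fourier_natCast]
    rfl

theorem toL2_ratio_mem_hardy (ha : ∀ j, ‖a j‖ < 1) (p : ℂ[X]) : toL2 (ratio a p) ∈ hardy :=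
  toL2_mem_hardy (ratio_mem_discAlgebra ha p)

namespace IsBlaschke

theorem smul_aeval_num (h : IsBlaschke c a α) :
    c • aeval coord (num a) = boundaryValue c a * aeval coord (den a) := by
  rw [boundaryValue, ratio_apply, smul_mul_assoc, mul_assoc, mul_comm (invDen a),
    aeval_coord_den_mul_invDen h.norm_zero_lt, mul_one]

theorem exists_coord_mul_ratio_eq (h : IsBlaschke c a α) {p : ℂ[X]} (hp : p ∈ degreeLT ℂ m) :
    ∃ q ∈ degreeLT ℂ m, coord * ratio a q = boundaryValue c a * star (ratio a p) := by
  obtain ⟨q, hq, e⟩ := exists_coord_mul_aeval_eq hp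
  have hden := congrArg star (aeval_coord_den_mul_invDen h.norm_zero_lt)
  rw [star_mul, star_one] at hden
  refine ⟨c • q, Submodule.smul_mem _ c hq, ?_⟩
  rw [map_smul, boundaryValue, ratio_apply, ratio_apply, ratio_apply, aeval_coord_num,
    mul_smul_comm, smul_mul_assoc, star_mul, ← mul_assoc, e]
  congr 1
  linear_combination -(coord ^ m * star (aeval coord p) * invDen a) * hden

theorem mem_mulHardy_iff (h : IsBlaschke c a α) {v : L2} :
    v ∈ mulHardy α ↔ ∃ u ∈ hardy, mulLp (boundaryValue c a) u = v := by
  refine exists_congr fun u => and_congr_right fun _ => ?_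
  have hmul : mulLp (boundaryValue c a) u =ᵐ[arc] fun t => α (pt t) * u t := by
    simpa only [h.boundaryValue_apply] using coeFn_mulLp (boundaryValue c a) u
  exact ⟨fun hv => Lp.ext (hmul.trans (.symm hv)), fun e => e ▸ hmul⟩

theorem mem_K_iff (h : IsBlaschke c a α) {u : L2} :
    u ∈ K α ↔ u ∈ hardy ∧ ∀ v ∈ hardy, ⟪mulLp (boundaryValue c a) v, u⟫_ℂ = 0 := by
  rw [K, Submodule.mem_inf, Submodule.mem_orthogonal]
  refine and_congr_right fun _ => ⟨fun hu v hv => hu _ (h.mem_mulHardy_iff.mpr ⟨v, hv, rfl⟩),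
    fun hu v hv => ?_⟩
  obtain ⟨w, hw, rfl⟩ := h.mem_mulHardy_iff.mp hv
  exact hu w hw

theorem toL2_ratio_mem_K (h : IsBlaschke c a α) {p : ℂ[X]} (hp : p ∈ degreeLT ℂ m) :
    toL2 (ratio a p) ∈ K α := by
  refine h.mem_K_iff.mpr ⟨toL2_ratio_mem_hardy h.norm_zero_lt p, fun v hv => ?_⟩
  obtain ⟨q, -, e⟩ := h.exists_coord_mul_ratio_eq hp
  calc ⟪mulLp (boundaryValue c a) v, toL2 (ratio a p)⟫_ℂ
      = ⟪mulLp (star (ratio a p)) (mulLp (boundaryValue c a) v), toL2 1⟫_ℂ := by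
        rw [inner_mulLp_left (star _), star_star, mulLp_toLp, mul_one]
    _ = ⟪mulLp coord (mulLp (ratio a q) v), toL2 1⟫_ℂ := by
        rw [← mulLp_mul, mul_comm, ← e, mulLp_mul]
    _ = 0 := by
        rw [← inner_conj_symm, inner_one_mulLp_coord
          (mulLp_mem_hardy (ratio_mem_discAlgebra h.norm_zero_lt q) hv), map_zero]

theorem exists_toL2_ratio_eq (h : IsBlaschke c a α) {u : L2} (hu : u ∈ K α) :
    ∃ p ∈ degreeLT ℂ m, toL2 (ratio a p) = u := by
  obtain ⟨hu, horth⟩ := h.mem_K_iff.mp hu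
  have hv := mulLp_mem_hardy (aeval_coord_mem_discAlgebra (den a)) hu
  obtain ⟨p, hp, e⟩ := exists_toL2_aeval_eq_of_mem_hardy (m := m) hv fun k => by
    have hden : star (aeval coord (den a)) * coord ^ (m + k)
        = conj c • (boundaryValue c a * (aeval coord (den a) * coord ^ k)) := by
      rw [← mul_assoc, ← h.smul_aeval_num, smul_mul_assoc, smul_smul, h.star_mul_self_const,
        one_smul, aeval_coord_num, pow_add]
      ring
    have hmem : toL2 (aeval coord (den a) * coord ^ k) ∈ hardy :=
      toL2_mem_hardy (mul_mem (aeval_coord_mem_discAlgebra _)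
        (pow_mem (Algebra.elemental.self_mem ℂ coord) k))
    rw [← star_star (aeval coord (den a)), ← inner_mulLp_left, mulLp_toLp, hden, map_smul,
      inner_smul_left, ← mulLp_toLp, horth _ hmem, mul_zero]
  refine ⟨p, hp, ?_⟩
  rw [ratio_apply, mul_comm, ← mulLp_toLp, e, ← mulLp_mul, mul_comm,
    aeval_coord_den_mul_invDen h.norm_zero_lt, mulLp_one]

theorem memLp_top (h : IsBlaschke c a α) {u : L2} (hu : u ∈ K α) : MemLp u ∞ arc := by
  obtain ⟨p, -, rfl⟩ := h.exists_toL2_ratio_eq hu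
  exact (Lp.memLp (ContinuousMap.toLp ∞ arc ℂ (ratio a p))).ae_eq
    ((ContinuousMap.coeFn_toLp arc _).trans (ContinuousMap.coeFn_toLp arc _).symm)

end IsBlaschke

end ModelSpaces

section Polynomials

theorem mul_mem_degreeLT {R : Type*} [Semiring R] {P q : R[X]} {m n : ℕ} (hmn : P.natDegree + n ≤ m)
    (hq : q ∈ degreeLT R n) : P * q ∈ degreeLT R m := by
  rw [mem_degreeLT] at hq ⊢
  rcases eq_or_ne q 0 with rfl | hq0
  · simp
  · rw [← natDegree_lt_iff_degree_lt hq0] at hq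
    refine (degree_le_natDegree.trans (mod_cast natDegree_mul_le)).trans_lt (mod_cast ?_ :
      ((P.natDegree + q.natDegree : ℕ) : WithBot ℕ) < m)
    omega

theorem finrank_map_degreeLT {F V : Type*} [Field F] [AddCommGroup V] [Module F V]
    {f : F[X] →ₗ[F] V} (hf : Function.Injective f) (n : ℕ) :
    Module.finrank F ((degreeLT F n).map f) = n := by
  rw [← ((degreeLTEquiv F n).symm ≪≫ₗ Submodule.equivMapOfInjective f hf _).finrank_eq,
    Module.finrank_fin_fun]

theorem exists_eq_smul_of_mem_orthogonal {𝕜 E : Type*} [RCLike 𝕜] [NormedAddCommGroup E]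
    [InnerProductSpace 𝕜 E] {W V : Submodule 𝕜 E} [FiniteDimensional 𝕜 V] (hWV : W ≤ V)
    (hdim : Module.finrank 𝕜 W + 1 = Module.finrank 𝕜 V) {x u : E} (hx : x ∈ V) (hx0 : x ≠ 0)
    (hxW : x ∈ Wᗮ) (hu : u ∈ V) (huW : u ∈ Wᗮ) : ∃ r : 𝕜, u = r • x := by
  have hone := Submodule.finrank_add_inf_finrank_orthogonal' hWV hdim
  obtain ⟨r, hr⟩ := (finrank_eq_one_iff_of_nonzero' (⟨x, hxW, hx⟩ : ↥(Wᗮ ⊓ V))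
    fun h0 => hx0 (congrArg Subtype.val h0)).mp hone ⟨u, huW, hu⟩
  exact ⟨r, (congrArg Subtype.val hr).symm⟩

theorem injective_aeval_coord :
    Function.Injective (aeval coord : ℂ[X] →ₐ[ℂ] C(UnitAddCircle, ℂ)) := by
  refine (injective_iff_map_eq_zero _).mpr fun p hp => ?_
  refine p.eq_zero_of_infinite_isRoot ((Set.infinite_range_of_injective injective_pt).mono ?_)
  rintro _ ⟨t, rfl⟩
  simpa [aeval_continuousMap_apply] using congrArg (· t) hp

theorem star_aeval_X_sub_C_mul_coord (w : ℂ) :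
    star (aeval coord (X - C w)) * coord = aeval coord (1 - C (conj w) * X) := by
  simp only [map_sub, aeval_X, aeval_C, map_one, map_mul, star_sub, sub_mul, star_coord_mul_coord,
    Algebra.algebraMap_eq_smul_one, star_smul, star_one, RCLike.star_def]

theorem star_aeval_one_sub_C_mul_X_mul_coord (w : ℂ) :
    star (aeval coord (1 - C (conj w) * X)) * coord = aeval coord (X - C w) := by
  rw [← star_aeval_X_sub_C_mul_coord, star_mul, star_star, mul_right_comm, star_coord_mul_coord,
    one_mul]

theorem mulLp_aeval_X_sub_C (w : ℂ) (u : L2) :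
    mulLp (aeval coord (X - C w)) u = mulLp coord u - w • u := by
  rw [map_sub, aeval_X, aeval_C, Algebra.algebraMap_eq_smul_one, map_sub, map_smul,
    sub_apply, smul_apply, mulLp_one]

theorem mulLp_aeval_one_sub_C_mul_X (w : ℂ) (u : L2) :
    mulLp (aeval coord (1 - C w * X)) u = u - w • mulLp coord u := by
  rw [map_sub, map_one, map_mul, aeval_X, aeval_C, ← Algebra.smul_def, map_sub, map_smul,
    sub_apply, smul_apply, mulLp_one]

end Polynomials

section ShiftDomain

variable {m : ℕ} {c : ℂ} {a : Fin m → ℂ} {α : ℂ → ℂ}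

theorem injective_toL2_ratio (ha : ∀ j, ‖a j‖ < 1) :
    Function.Injective (toL2.toLinearMap ∘ₗ ratio a) := by
  refine (ContinuousMap.toLp_injective arc).comp fun p q h => injective_aeval_coord ?_
  have hunit : IsUnit (invDen a) := .of_mul_eq_one_right _ (aeval_coord_den_mul_invDen ha)
  exact hunit.mul_left_injective h

/-- The functions `x ∈ K_α` with `zx ∈ K_α`: on these the compressed shift of `K_α` is plain
multiplication by `z`. -/
def shiftDomain (α : ℂ → ℂ) : Submodule ℂ L2 := K α ⊓ (K α).comap (mulLp coord).toLinearMap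

namespace IsBlaschke

theorem map_degreeLT_eq_K (h : IsBlaschke c a α) :
    (degreeLT ℂ m).map (toL2.toLinearMap ∘ₗ ratio a) = K α :=
  le_antisymm (Submodule.map_le_iff_le_comap.mpr fun _ => h.toL2_ratio_mem_K)
    fun _ => h.exists_toL2_ratio_eq

theorem toL2_ratio_mem_shiftDomain (h : IsBlaschke c a α) {n : ℕ} (hn : n < m) {q : ℂ[X]}
    (hq : q ∈ degreeLT ℂ n) : toL2 (ratio a q) ∈ shiftDomain α := by
  refine ⟨h.toL2_ratio_mem_K (degreeLT_mono hn.le hq), ?_⟩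
  have hXq : X * q ∈ degreeLT ℂ m := mul_mem_degreeLT (by rw [natDegree_X]; omega) hq
  simpa [ratio_mul, mulLp_toLp] using h.toL2_ratio_mem_K hXq

theorem inner_toL2_eq_zero (h : IsBlaschke c a α) {φ ψ : C(UnitAddCircle, ℂ)} {s t : ℂ}
    (hφ : ψ * φ = s • 1 + t • boundaryValue c a) {y : L2} (hy : y ∈ shiftDomain α) :
    ⟪toL2 φ, mulLp (star ψ * coord) y⟫_ℂ = 0 := by
  have hb : ⟪toL2 (boundaryValue c a), mulLp coord y⟫_ℂ = 0 := by
    simpa [mulLp_toLp] using (h.mem_K_iff.mp hy.2).2 _ toL2_one_mem_hardy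
  rw [mulLp_mul, ← inner_mulLp_left, mulLp_toLp, hφ, map_add, map_smul, map_smul, inner_add_left,
    inner_smul_left, inner_smul_left, inner_one_mulLp_coord hy.1.1, hb, mul_zero, mul_zero,
    add_zero]

theorem finrank_K (h : IsBlaschke c a α) : Module.finrank ℂ (K α) = m := by
  rw [← h.map_degreeLT_eq_K, finrank_map_degreeLT (injective_toL2_ratio h.norm_zero_lt)]

theorem exists_eq_smul_of_forall_inner_eq_zero (h : IsBlaschke c a α) (hm : 0 < m) {P : ℂ[X]}
    (hP : P ≠ 0) (hdeg : P.natDegree ≤ 1) {x u : L2} (hx : x ∈ K α) (hx0 : x ≠ 0)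
    (hxP : ∀ y ∈ shiftDomain α, ⟪x, mulLp (aeval coord P) y⟫_ℂ = 0) (hu : u ∈ K α)
    (huP : ∀ y ∈ shiftDomain α, ⟪u, mulLp (aeval coord P) y⟫_ℂ = 0) :
    ∃ r : ℂ, u = r • x := by
  have : FiniteDimensional ℂ (K α) := .of_finrank_pos (h.finrank_K ▸ hm)
  have hinj : Function.Injective ((toL2.toLinearMap ∘ₗ ratio a) ∘ₗ LinearMap.mulLeft ℂ P) :=
    (injective_toL2_ratio h.norm_zero_lt).comp fun _ _ => mul_left_cancel₀ hP
  let W := (degreeLT ℂ (m - 1)).map ((toL2.toLinearMap ∘ₗ ratio a) ∘ₗ LinearMap.mulLeft ℂ P)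
  have hWK : W ≤ K α := by
    rintro _ ⟨q, hq, rfl⟩
    exact h.toL2_ratio_mem_K (mul_mem_degreeLT (by omega) hq)
  have hdim : Module.finrank ℂ W + 1 = Module.finrank ℂ (K α) := by
    rw [finrank_map_degreeLT hinj, h.finrank_K, Nat.sub_add_cancel hm]
  have hortho {v : L2} (hvP : ∀ y ∈ shiftDomain α, ⟪v, mulLp (aeval coord P) y⟫_ℂ = 0) :
      v ∈ Wᗮ := by
    rw [Submodule.mem_orthogonal']
    rintro _ ⟨q, hq, rfl⟩
    have := hvP _ (h.toL2_ratio_mem_shiftDomain (by omega) hq)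
    rwa [mulLp_toLp, ← ratio_mul] at this
  exact exists_eq_smul_of_mem_orthogonal hWK hdim hx hx0 (hortho hxP) hu (hortho huP)

theorem exists_inner_ne_zero (h : IsBlaschke c a α) (hm : 1 < m) {u : L2} (hu : u ∈ K α)
    (hu0 : u ≠ 0) : ∃ x ∈ shiftDomain α, ⟪u, x⟫_ℂ ≠ 0 ∨ ⟪u, mulLp coord x⟫_ℂ ≠ 0 := by
  by_contra! hzero
  obtain ⟨p, hp, rfl⟩ := h.exists_toL2_ratio_eq hu
  have hC : C (p.coeff 0) ∈ degreeLT ℂ 1 := mem_degreeLT.mpr (degree_C_lt.trans_le le_rfl)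
  have hdiv : divX p ∈ degreeLT ℂ (m - 1) := by
    refine mem_degreeLT.mpr ((degree_lt_iff_coeff_zero _ _).mpr fun k hk => ?_)
    rw [coeff_divX]
    exact (degree_lt_iff_coeff_zero _ _).mp (mem_degreeLT.mp hp) (k + 1) (by omega)
  refine hu0 (inner_self_eq_zero (𝕜 := ℂ).mp ?_)
  nth_rw 2 [← X_mul_divX_add p]
  rw [map_add, map_add, ratio_mul, aeval_X, ← mulLp_toLp, inner_add_right,
    (hzero _ (h.toL2_ratio_mem_shiftDomain (by omega) hdiv)).2,
    (hzero _ (h.toL2_ratio_mem_shiftDomain hm hC)).1, add_zero]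

end IsBlaschke

end ShiftDomain

section Kernels

variable {m : ℕ} {c : ℂ} {a : Fin m → ℂ} {α : ℂ → ℂ} {w : ℂ}

theorem one_sub_conj_mul_ne_zero {v z : ℂ} (hv : ‖v‖ < 1) (hz : ‖z‖ ≤ 1) :
    1 - conj v * z ≠ 0 := by
  refine sub_ne_zero.mpr fun e => (congrArg norm e).not_gt ?_
  rw [norm_mul, Complex.norm_conj, norm_one]
  exact mul_lt_one_of_nonneg_of_lt_one_left (norm_nonneg _) hv hz

theorem one_sub_conj_mul_ne_zero_of_ne {z v : ℂ} (hz : ‖z‖ = 1) (hzv : z ≠ v) :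
    1 - conj v * z ≠ 0 := by
  have hz1 : conj z * z = 1 := by simp [Complex.conj_mul', hz]
  rw [← hz1, ← sub_mul, ← map_sub]
  exact mul_ne_zero ((_root_.map_ne_zero _).mpr (sub_ne_zero.mpr hzv))
    (right_ne_zero_of_mul_eq_one hz1)

namespace IsBlaschke

theorem mul_eval_den (h : IsBlaschke c a α) (hw : ‖w‖ ≤ 1) :
    α w * (den a).eval w = c * (num a).eval w := by
  simp only [h.apply_eq w hw, den, num, eval_prod, eval_sub, eval_one, eval_mul, eval_C, eval_X,
    mul_assoc, ← Finset.prod_mul_distrib]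
  congr 1
  exact Finset.prod_congr rfl fun j _ =>
    div_mul_cancel₀ _ (one_sub_conj_mul_ne_zero (h.norm_zero_lt j) hw)

theorem boundaryValue_ne_smul_one (h : IsBlaschke c a α) (hm : 0 < m) (s : ℂ) :
    boundaryValue c a ≠ s • 1 := by
  intro e
  have hpoly : c • num a = s • den a := injective_toL2_ratio h.norm_zero_lt <|
    congrArg toL2 (by rw [map_smul, map_smul, ratio_den h.norm_zero_lt, ← e, boundaryValue])
  have hnum : (num a).eval (a ⟨0, hm⟩) = 0 := by
    rw [num, eval_prod]
    exact Finset.prod_eq_zero (Finset.mem_univ ⟨0, hm⟩) (by simp)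
  have hden : (den a).eval (a ⟨0, hm⟩) ≠ 0 := by
    simpa [den, eval_prod, Finset.prod_ne_zero_iff] using fun j =>
      one_sub_conj_mul_ne_zero (h.norm_zero_lt j) (h.norm_zero_lt ⟨0, hm⟩).le
  have hs : s = 0 := by
    simpa [hnum, hden] using (congrArg (eval (a ⟨0, hm⟩)) hpoly).symm
  have hc : c ≠ 0 := right_ne_zero_of_mul_eq_one h.star_mul_self_const
  rw [hs, zero_smul] at hpoly
  exact smul_ne_zero hc (num_ne_zero a) hpoly

theorem exists_coord_sub_mul_ratio_eq (h : IsBlaschke c a α) (hw : ‖w‖ ≤ 1) :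
    ∃ p ∈ degreeLT ℂ m, aeval coord (X - C w) * ratio a p = boundaryValue c a - α w • 1 := by
  set N := c • num a - α w • den a with hN
  have hroot : N.IsRoot w := by simp [hN, h.mul_eval_den hw]
  have hdeg : N.natDegree ≤ m :=
    (natDegree_sub_le _ _).trans (max_le ((natDegree_smul_le _ _).trans (natDegree_num_le a))
      ((natDegree_smul_le _ _).trans (natDegree_den_le a)))
  refine ⟨N /ₘ (X - C w), mem_degreeLT.mpr ?_, ?_⟩
  · rcases eq_or_ne N 0 with h0 | h0
    · simp [h0]
    · exact (degree_divByMonic_lt _ _ h0 (by rw [degree_X_sub_C]; exact one_pos)).trans_le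
        (degree_le_of_natDegree_le hdeg)
  · rw [← ratio_mul, mul_divByMonic_eq_iff_isRoot.mpr hroot, hN, map_sub, map_smul, map_smul,
      ratio_den h.norm_zero_lt, boundaryValue]

theorem exists_one_sub_coord_mul_ratio_eq (h : IsBlaschke c a α) (hw : ‖w‖ ≤ 1) :
    ∃ q ∈ degreeLT ℂ m,
      aeval coord (1 - C (conj w) * X) * ratio a q = 1 - conj (α w) • boundaryValue c a := by
  obtain ⟨p, hp, hpw⟩ := h.exists_coord_sub_mul_ratio_eq hw
  obtain ⟨q, hq, hqp⟩ := h.exists_coord_mul_ratio_eq hp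
  refine ⟨q, hq, ?_⟩
  calc aeval coord (1 - C (conj w) * X) * ratio a q
      = star (aeval coord (X - C w) * ratio a p) * boundaryValue c a := by
        rw [← star_aeval_X_sub_C_mul_coord, mul_assoc, hqp, star_mul]
        ring
    _ = 1 - conj (α w) • boundaryValue c a := by
        rw [hpw, star_sub, star_smul, star_one, sub_mul, h.star_boundaryValue_mul_boundaryValue,
          smul_one_mul, RCLike.star_def]

theorem isScalarMultiple_iff_of_mem_K (h : IsBlaschke c a α) (hm : 0 < m) {P : ℂ[X]}
    (hP : P ≠ 0) (hdeg : P.natDegree ≤ 1) {x u : L2} {k : ℂ → ℂ} (hx : x ∈ K α) (hx0 : x ≠ 0)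
    (hxk : ∀ᵐ t ∂arc, x t = k (pt t))
    (hxP : ∀ y ∈ shiftDomain α, ⟪x, mulLp (aeval coord P) y⟫_ℂ = 0) (hu : u ∈ K α) :
    IsScalarMultiple u k ↔ ∀ y ∈ shiftDomain α, ⟪u, mulLp (aeval coord P) y⟫_ℂ = 0 := by
  have hmul : IsScalarMultiple u k ↔ ∃ r : ℂ, u = r • x := by
    refine exists_congr fun r => ⟨fun hr => Lp.ext ?_, ?_⟩
    · filter_upwards [hr, hxk, Lp.coeFn_smul r x] with t hr hxk hrx
      rw [hr, hrx, Pi.smul_apply, hxk, smul_eq_mul]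
    · rintro rfl
      filter_upwards [hxk, Lp.coeFn_smul r x] with t hxk hrx
      rw [hrx, Pi.smul_apply, hxk, smul_eq_mul]
  rw [hmul]
  refine ⟨?_, h.exists_eq_smul_of_forall_inner_eq_zero hm hP hdeg hx hx0 hxP hu⟩
  rintro ⟨r, rfl⟩ y hy
  rw [inner_smul_left, hxP y hy, mul_zero]

theorem isScalarMultiple_conjKernel_iff (h : IsBlaschke c a α) (hm : 0 < m) (hw : ‖w‖ ≤ 1)
    {u : L2} (hu : u ∈ K α) : IsScalarMultiple u (conjKernel α w) ↔
      ∀ x ∈ shiftDomain α, ⟪u, x⟫_ℂ = conj w * ⟪u, mulLp coord x⟫_ℂ := by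
  obtain ⟨p, hp, hpw⟩ := h.exists_coord_sub_mul_ratio_eq hw
  have hp0 : ratio a p ≠ 0 := by
    intro h0
    rw [h0, mul_zero] at hpw
    exact h.boundaryValue_ne_smul_one hm _ (sub_eq_zero.mp hpw.symm)
  rw [h.isScalarMultiple_iff_of_mem_K hm (P := 1 - C (conj w) * X)
    (fun h0 => by simpa using congrArg (eval 0) h0) (by compute_degree)
    (h.toL2_ratio_mem_K hp) (toL2_ne_zero hp0) ?_ ?_ hu]
  · simp_rw [mulLp_aeval_one_sub_C_mul_X, inner_sub_right, inner_smul_right, sub_eq_zero]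
  · filter_upwards [ContinuousMap.coeFn_toLp arc (𝕜 := ℂ) (p := 2) (ratio a p), ae_pt_ne w]
      with t ht hne
    rw [ht, conjKernel_eq _ _ _ (norm_pt t) (h.norm_apply_pt t), eq_div_iff (sub_ne_zero.mpr hne),
      mul_comm]
    simpa [h.boundaryValue_apply] using congrArg (· t) hpw
  · intro y hy
    rw [← star_aeval_X_sub_C_mul_coord]
    exact h.inner_toL2_eq_zero
      (hpw.trans (by module : _ = (-α w) • 1 + (1 : ℂ) • boundaryValue c a)) hy

theorem isScalarMultiple_kernel_iff (h : IsBlaschke c a α) (hm : 0 < m) (hw : ‖w‖ ≤ 1)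
    {u : L2} (hu : u ∈ K α) : IsScalarMultiple u (kernel α w) ↔
      ∀ x ∈ shiftDomain α, ⟪u, mulLp coord x⟫_ℂ = w * ⟪u, x⟫_ℂ := by
  obtain ⟨q, hq, hqw⟩ := h.exists_one_sub_coord_mul_ratio_eq hw
  have hq0 : ratio a q ≠ 0 := by
    intro h0
    rw [h0, mul_zero, eq_comm, sub_eq_zero] at hqw
    refine h.boundaryValue_ne_smul_one hm (α w) ?_
    calc boundaryValue c a
        = star (conj (α w) • boundaryValue c a) * boundaryValue c a := by
          rw [← hqw, star_one, one_mul]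
      _ = α w • 1 := by
        rw [star_smul, smul_mul_assoc, h.star_boundaryValue_mul_boundaryValue,
          RCLike.star_def, Complex.conj_conj]
  rw [h.isScalarMultiple_iff_of_mem_K hm (X_sub_C_ne_zero w) (natDegree_X_sub_C_le w)
    (h.toL2_ratio_mem_K hq) (toL2_ne_zero hq0) ?_ ?_ hu]
  · simp_rw [mulLp_aeval_X_sub_C, inner_sub_right, inner_smul_right, sub_eq_zero]
  · filter_upwards [ContinuousMap.coeFn_toLp arc (𝕜 := ℂ) (p := 2) (ratio a q), ae_pt_ne w]
      with t ht hne
    rw [ht, kernel, eq_div_iff (one_sub_conj_mul_ne_zero_of_ne (norm_pt t) hne), mul_comm]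
    simpa [h.boundaryValue_apply] using congrArg (· t) hqw
  · intro y hy
    rw [← star_aeval_one_sub_C_mul_X_mul_coord]
    exact h.inner_toL2_eq_zero
      (hqw.trans (by module : _ = (1 : ℂ) • 1 + (-conj (α w)) • boundaryValue c a)) hy

end IsBlaschke
end Kernels

section RankOne

theorem forall_eq_mul_iff_of_mul_eq_mul {ι κ F : Type*} [Field F] {s : Set ι} {t : Set κ}
    {p p' : ι → F} {q q' : κ → F} (hpq : ∀ i ∈ s, ∀ j ∈ t, p' i * q' j = p i * q j)
    (hp : ∃ i ∈ s, p i ≠ 0 ∨ p' i ≠ 0) (hq : ∃ j ∈ t, q j ≠ 0 ∨ q' j ≠ 0) (r : F) :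
    (∀ j ∈ t, q' j = r * q j) ↔ ∀ i ∈ s, p i = r * p' i := by
  refine ⟨fun h i hi => ?_, fun h j hj => ?_⟩
  · obtain ⟨j, hj, hne⟩ := hq
    have hqj : q j ≠ 0 := hne.elim id (mt fun h0 => by rw [h j hj, h0, mul_zero])
    refine mul_right_cancel₀ hqj ?_
    rw [← hpq i hi j hj, h j hj]
    ring
  · obtain ⟨i, hi, hne⟩ := hp
    have hpi : p' i ≠ 0 := hne.elim (mt fun h0 => by rw [h i hi, h0, mul_zero]) id
    refine mul_left_cancel₀ hpi ?_
    rw [hpq i hi j hj, h i hi]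
    ring

theorem inner_mulBdd (φ f g : L2) (hf : MemLp f ∞ arc) :
    ⟪g, mulBdd φ f hf⟫_ℂ = ∫ t, φ t * f t * conj (g t) ∂arc := by
  rw [L2.inner_def]
  refine integral_congr_ae ?_
  filter_upwards [MemLp.coeFn_toLp (hf.mul' (Lp.memLp φ) : MemLp _ 2 arc)] with t ht
  rw [mulBdd, ht, RCLike.inner_apply]

theorem inner_mulLp_coord_mulBdd {φ f g : L2} (hf : MemLp f ∞ arc)
    (hf' : MemLp (mulLp coord f) ∞ arc) :
    ⟪mulLp coord g, mulBdd φ (mulLp coord f) hf'⟫_ℂ = ⟪g, mulBdd φ f hf⟫_ℂ := by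
  rw [inner_mulBdd, inner_mulBdd]
  refine integral_congr_ae ?_
  filter_upwards [coeFn_mulLp coord f, coeFn_mulLp coord g] with t htf htg
  have hz : conj (pt t) * pt t = 1 := congrArg (· t) star_coord_mul_coord
  rw [htf, htg, map_mul, coord_apply]
  linear_combination φ t * f t * conj (g t) * hz

variable {m n : ℕ} {α β : ℂ → ℂ} {w : ℂ}

theorem inner_attOperator_eq {c : ℂ} {a : Fin m → ℂ} (h : IsBlaschke c a α)
    {A : K α →L[ℂ] K β} (hA : A ∈ attOperators α β) {x y : L2} (hx : x ∈ K α)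
    (hzx : mulLp coord x ∈ K α) (hy : y ∈ K β) (hzy : mulLp coord y ∈ K β) :
    ⟪mulLp coord y, (A ⟨mulLp coord x, hzx⟩ : L2)⟫_ℂ = ⟪y, (A ⟨x, hx⟩ : L2)⟫_ℂ := by
  obtain ⟨φ, hφ⟩ := hA
  have hproj {v : L2} (hv : v ∈ K β) (u : L2) :
      ⟪v, ((K β).orthogonalProjectionOnto u : L2)⟫_ℂ = ⟪v, u⟫_ℂ :=
    Submodule.inner_orthogonalProjectionOnto_eq_of_mem_left ⟨v, hv⟩ u
  rw [hφ ⟨_, hzx⟩ (h.memLp_top hzx), hφ ⟨_, hx⟩ (h.memLp_top hx), hproj hzy, hproj hy,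
    inner_mulLp_coord_mulBdd]

theorem inner_mul_inner_eq_of_rankOne_mem {c : ℂ} {a : Fin m → ℂ} (h : IsBlaschke c a α)
    {f : K α} {g : K β} (hgf : InnerProductSpace.rankOne ℂ g f ∈ attOperators α β) {x y : L2}
    (hx : x ∈ shiftDomain α) (hy : y ∈ shiftDomain β) :
    ⟪(f : L2), mulLp coord x⟫_ℂ * ⟪mulLp coord y, (g : L2)⟫_ℂ
      = ⟪(f : L2), x⟫_ℂ * ⟪y, (g : L2)⟫_ℂ := by
  simpa only [InnerProductSpace.rankOne_apply, Submodule.coe_smul, inner_smul_right,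
    Submodule.coe_inner] using inner_attOperator_eq h hgf hx.1 hx.2 hy.1 hy.2

theorem isScalarMultiple_kernel_iff_conjKernel {c : ℂ} {a : Fin m → ℂ} {d : ℂ} {b : Fin n → ℂ}
    (hα : IsBlaschke c a α) (hβ : IsBlaschke d b β) (hm : 1 < m) (hn : 1 < n) {f g : L2}
    (hf : f ∈ K α) (hg : g ∈ K β) (hf0 : f ≠ 0) (hg0 : g ≠ 0)
    (hshift : ∀ x ∈ shiftDomain α, ∀ y ∈ shiftDomain β,
      ⟪f, mulLp coord x⟫_ℂ * ⟪mulLp coord y, g⟫_ℂ = ⟪f, x⟫_ℂ * ⟪y, g⟫_ℂ) (hw : ‖w‖ ≤ 1) :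
    IsScalarMultiple g (kernel β w) ↔ IsScalarMultiple f (conjKernel α w) := by
  have hconj (y : L2) : ⟪g, mulLp coord y⟫_ℂ = w * ⟪g, y⟫_ℂ ↔
      ⟪mulLp coord y, g⟫_ℂ = conj w * ⟪y, g⟫_ℂ := by
    rw [← inner_conj_symm _ g, ← inner_conj_symm y g, ← map_mul, (starRingEnd ℂ).injective.eq_iff]
  obtain ⟨y, hy, hgy⟩ := hβ.exists_inner_ne_zero hn hg hg0
  rw [hα.isScalarMultiple_conjKernel_iff (by omega) hw hf,
    hβ.isScalarMultiple_kernel_iff (by omega) hw hg]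
  simp_rw [hconj]
  exact forall_eq_mul_iff_of_mul_eq_mul (p := fun x => ⟪f, x⟫_ℂ) (q := fun y => ⟪y, g⟫_ℂ) hshift
    (hα.exists_inner_ne_zero hm hf hf0)
    ⟨y, hy, hgy.imp (mt inner_eq_zero_symm.mp) (mt inner_eq_zero_symm.mp)⟩ (conj w)

end RankOne

end ModelSpace

end

theorem mainTheorem7 (m n : ℕ) (hm : 1 < m) (hn : 1 < n) (α β : ℂ → ℂ)
    (hα : ModelSpace.IsFiniteBlaschke m α) (hβ : ModelSpace.IsFiniteBlaschke n β)
    (f : ModelSpace.K α) (g : ModelSpace.K β) (hf : f ≠ 0) (hg : g ≠ 0)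
    (hgf : InnerProductSpace.rankOne ℂ g f ∈ ModelSpace.attOperators α β)
    (w : ℂ) (hw : ‖w‖ ≤ 1) :
    (ModelSpace.IsScalarMultiple (g : ModelSpace.L2) (ModelSpace.kernel β w) ↔
      ModelSpace.IsScalarMultiple (f : ModelSpace.L2) (ModelSpace.conjKernel α w)) ∧
    (ModelSpace.IsScalarMultiple (g : ModelSpace.L2) (ModelSpace.conjKernel β w) ↔
      ModelSpace.IsScalarMultiple (f : ModelSpace.L2) (ModelSpace.kernel α w)) := by
  obtain ⟨c, a, hα⟩ := hα.exists_isBlaschke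
  obtain ⟨d, b, hβ⟩ := hβ.exists_isBlaschke
  have hf0 : (f : ModelSpace.L2) ≠ 0 := by simpa using hf
  have hg0 : (g : ModelSpace.L2) ≠ 0 := by simpa using hg
  have hshift := fun x hx y hy => ModelSpace.inner_mul_inner_eq_of_rankOne_mem hα hgf
    (x := x) (y := y) hx hy
  constructor
  · exact ModelSpace.isScalarMultiple_kernel_iff_conjKernel hα hβ hm hn f.2 g.2 hf0 hg0 hshift hw
  · refine (ModelSpace.isScalarMultiple_kernel_iff_conjKernel hβ hα hn hm g.2 f.2 hg0 hf0
      (fun y hy x hx => ?_) hw).symm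
    simpa only [map_mul, inner_conj_symm, mul_comm] using
      congrArg (starRingEnd ℂ) (hshift x hx y hy)
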